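/- Let $\Bbbk$ be a totally ordered division ring (not necessarily commutative), and let $J$ be a set with a subset $I\subseteq J$. Denote by $\Bbbk^{(J)}$ the set of all finitely supported families $(x_j)_{j\in J}$ of elements of $\Bbbk$, and identify $\Bbbk^{(I)}$ with the set of all elements of $\Bbbk^{(J)}$ whose support is contained in $I$. Each $a\in\Bbbk^{(J)}$ is identified with the linear functional $x\mapsto\sum_{j\in J}a_jx_j$ on the right $\Bbbk$-vector space $\Bbbk^{(J)}$. For $\mathcal{F}\subseteq\Bbbk^{(J)}$, let $\operatorname{Op}^-(\mathcal{F},\Bbbk^{(J)})$ be the sublattice of the powerset of $\Bbbk^{(J)}$ generated by all sets $\{x\in\Bbbk^{(J)} : a(x)>0\}$ and $\{x\in\Bbbk^{(J)} : a(x)<0\}$ with $a\in\mathcal{F}$, and set $\operatorname{Op}(\mathcal{F},\Bbbk^{(J)})=\operatorname{Op}^-(\mathcal{F},\Bbbk^{(J)})\cup\{\Bbbk^{(J)}\}$. A $0$-lattice is a lattice with a least element $0$; a $0$-lattice homomorphism is a lattice homomorphism preserving $0$. A $0$-lattice $L$ is completely normal if for all $a,b\in L$ there are $u,v\in L$ with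 $a\leq u\vee b$, $b\leq a\vee v$, and $u\wedge v=0$. Denote by $L\cup\{\infty\}$ the lattice obtained by adding a new top element $\infty$ to $L$. A map $f\colon P\to Q$ between posets with top elements $\top_P$, $\top_Q$ is top-faithful if $f^{-1}\{\top_Q\}=\{\top_P\}$. Let $L$ be a completely normal distributive $0$-lattice, let $\mathcal{D}$ be a finite subset of $\Bbbk^{(J)}$, and let $e\in\Bbbk^{(J)}$. Then every top-faithful $0$-lattice homomorphism $f\colon\operatorname{Op}(\Bbbk^{(I)}\cup\mathcal{D},\Bbbk^{(J)})\to L\cup\{\infty\}$ extends to a top-faithful lattice homomorphism $g\colon\operatorname{Op}(\Bbbk^{(I)}\cup\mathcal{D}\cup\{e\},\Bbbk^{(J)})\to L\cup\{\infty\}$. -/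

import Mathlib

/-- Two elements `a`, `b` of a lattice with zero are consonant if there are `u`, `v` with
`a ≤ u ∨ b`, `b ≤ a ∨ v` and `u ∧ v = 0`. -/
def Consonant {L : Type*} [Lattice L] [OrderBot L] (a b : L) : Prop :=
  ∃ u v : L, a ≤ u ⊔ b ∧ b ≤ a ⊔ v ∧ u ⊓ v = ⊥

/-- A lattice with zero is completely normal if any two of its elements are consonant. -/
def CompletelyNormal (L : Type*) [Lattice L] [OrderBot L] : Prop :=
  ∀ a b : L, Consonant a b

/-- A map between posets with top is top-faithful if the inverse image of the top element consists
exactly of the top element. -/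
def TopFaithful {P Q : Type*} [PartialOrder P] [OrderTop P] [PartialOrder Q] [OrderTop Q]
    (f : P → Q) : Prop :=
  f ⁻¹' {⊤} = {⊤}

section Op

variable {Ω 𝕜 : Type*} [Zero 𝕜] [LT 𝕜]

/-- The sublattice `Op⁻(ℱ, Ω)` of the powerset of `Ω` generated by all sets `{f > 0}` and
`{f < 0}`, for `f ∈ ℱ`. -/
def OpMinus (F : Set (Ω → 𝕜)) : Sublattice (Set Ω) where
  carrier := latticeClosure {X | ∃ f ∈ F, X = {x | 0 < f x} ∨ X = {x | f x < 0}}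
  supClosed' := isSublattice_latticeClosure.supClosed
  infClosed' := isSublattice_latticeClosure.infClosed

/-- The lattice `Op(ℱ, Ω) = Op⁻(ℱ, Ω) ∪ {Ω}`. -/
def Op (F : Set (Ω → 𝕜)) : Sublattice (Set Ω) where
  carrier := (OpMinus F : Set (Set Ω)) ∪ {Set.univ}
  supClosed' := by
    rintro X (hX | rfl) Y (hY | rfl)
    · exact Or.inl ((OpMinus F).supClosed hX hY)
    · exact Or.inr (by simp)
    · exact Or.inr (by simp)
    · exact Or.inr (by simp)
  infClosed' := by
    rintro X (hX | rfl) Y (hY | rfl)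
    · exact Or.inl ((OpMinus F).infClosed hX hY)
    · exact Or.inl (by simpa using hX)
    · exact Or.inl (by simpa using hY)
    · exact Or.inr (by simp)

theorem Op_mono {F G : Set (Ω → 𝕜)} (h : F ⊆ G) : Op F ≤ Op G := by
  rintro X (hX | hX)
  · refine Or.inl (latticeClosure_mono ?_ hX)
    rintro Y ⟨f, hf, hY⟩
    exact ⟨f, h hf, hY⟩
  · exact Or.inr hX

theorem univ_mem_Op (F : Set (Ω → 𝕜)) : (Set.univ : Set Ω) ∈ Op F := Or.inr rfl

end Op

section Functionals

variable {𝕜 J : Type*} [DivisionRing 𝕜]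

/-- The linear functional `x ↦ ∑ j, a j * x j` on the right vector space `𝕜^(J)` associated to
`a ∈ 𝕜^(J)`. -/
def linFunctional (a : J →₀ 𝕜) : (J →₀ 𝕜) → 𝕜 :=
  fun x => a.sum fun j c => c * x j

/-- For `I ⊆ J`, the set `𝕜^(I)`, seen as the set of all vectors in `𝕜^(J)` with support
contained in `I`. -/
def kkp (𝕜 : Type*) {J : Type*} [DivisionRing 𝕜] (I : Set J) : Set (J →₀ 𝕜) :=
  {a | (a.support : Set J) ⊆ I}

variable [LinearOrder 𝕜]

/-- The lattice `Op(𝕜^(I) ∪ D, 𝕜^(J))`, where the elements of `𝕜^(I) ∪ D` are identified with the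
associated linear functionals on `𝕜^(J)`. -/
def OpK (I : Set J) (D : Set (J →₀ 𝕜)) : Sublattice (Set (J →₀ 𝕜)) :=
  Op (linFunctional '' (kkp 𝕜 I ∪ D))

theorem OpK_mono (I : Set J) {D D' : Set (J →₀ 𝕜)} (h : D ⊆ D') : OpK I D ≤ OpK I D' :=
  Op_mono (Set.image_mono (Set.union_subset_union_right _ h))

theorem empty_mem_OpK (I : Set J) (D : Set (J →₀ 𝕜)) : (∅ : Set (J →₀ 𝕜)) ∈ OpK I D := by
  refine Or.inl (subset_latticeClosure ⟨linFunctional 0, ⟨0, Or.inl ?_, rfl⟩, Or.inl ?_⟩)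
  · simp [kkp]
  · simp [linFunctional]

/-- The bottom of `Op(𝕜^(I) ∪ D, 𝕜^(J))` is the empty set and its top is `𝕜^(J)`. -/
instance instBoundedOrderOpK (I : Set J) (D : Set (J →₀ 𝕜)) : BoundedOrder (OpK I D) where
  top := ⟨Set.univ, univ_mem_Op _⟩
  le_top X := Set.subset_univ (X : Set (J →₀ 𝕜))
  bot := ⟨∅, empty_mem_OpK I D⟩
  bot_le X := Set.empty_subset (X : Set (J →₀ 𝕜))

end Functionals

/-!
Every element of the lattice generated by `Op F` and the disjoint half-spaces `P = {0 < e}` and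
`N = {e < 0}` has the form `X ∪ (Y ∩ P) ∪ (Z ∩ N)`, so extending `f` amounts to choosing disjoint
values `a`, `b` at `P`, `N` that satisfy the inequalities forced by the inclusions of the forms
`X ⊆ Y ∪ P`, `X ⊆ Y ∪ N`, `X ⊆ Y ∪ P ∪ N`, `X ∩ P ⊆ Y` and `X ∩ N ⊆ Y`.

Inclusions of the first two kinds only depend on the cells of `F` on which `e` has a constant sign;
by convexity, so do those of the third kind. The last two kinds only depend on the cells on which
`e` takes the sign in question somewhere. By Fourier–Motzkin elimination, finitely many functionals
`F₀ ⊆ F` decide which cells these are. Hence the cells on which `e > 0` are covered by finitely many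
differences `A \ B` with `A, B ∈ Op F`, where `A` is the open star of a cell of `F₀`; a small
perturbation shows that `e` is positive somewhere on every cell of `F` inside `A`. The same holds
for `e < 0`. Complete normality of `L` then allows one to shrink the values `f A` to the required
disjoint `a` and `b`. Neither of them is `∞`, and `∞` is join prime, so the extension is
top-faithful.
-/

open SignType (sign)

section NormalForm

variable {M : Type*} [DistribLattice M]

/-- The lattice polynomial `x ∨ (y ∧ a) ∨ (z ∧ b)`. When `a` and `b` are disjoint, its values for
`x, y, z` in a sublattice `K` are the normal forms of the elements generated by `K`, `a` and `b`. -/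
def normalForm (a b x y z : M) : M := x ⊔ y ⊓ a ⊔ z ⊓ b

theorem normalForm_self (a b x : M) : normalForm a b x x x = x := by
  simp [normalForm]

theorem normalForm_swap (a b x y z : M) : normalForm b a x z y = normalForm a b x y z :=
  sup_right_comm _ _ _

theorem normalForm_sup (a b x y z x' y' z' : M) :
    normalForm a b x y z ⊔ normalForm a b x' y' z' =
      normalForm a b (x ⊔ x') (y ⊔ y') (z ⊔ z') := by
  simp only [normalForm, inf_sup_right]
  ac_rfl

theorem normalForm_inf [OrderBot M] {a b : M} (hab : Disjoint a b) (x y z x' y' z' : M) :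
    normalForm a b x y z ⊓ normalForm a b x' y' z' =
      normalForm a b (x ⊓ x') (x ⊓ y' ⊔ y ⊓ x' ⊔ y ⊓ y') (x ⊓ z' ⊔ z ⊓ x' ⊔ z ⊓ z') := by
  have hya : y ⊓ a ⊓ (z' ⊓ b) = ⊥ := by rw [inf_inf_inf_comm, hab.eq_bot, inf_bot_eq]
  have hzb : z ⊓ b ⊓ (y' ⊓ a) = ⊥ := by rw [inf_inf_inf_comm, hab.symm.eq_bot, inf_bot_eq]
  have hyy : y ⊓ a ⊓ (y' ⊓ a) = y ⊓ y' ⊓ a := by rw [inf_inf_inf_comm, inf_idem]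
  have hzz : z ⊓ b ⊓ (z' ⊓ b) = z ⊓ z' ⊓ b := by rw [inf_inf_inf_comm, inf_idem]
  simp only [normalForm, inf_sup_left, inf_sup_right, hya, hzb, hyy, hzz, sup_bot_eq]
  ac_rfl

theorem le_normalForm_iff {a b w x y z : M} :
    w ≤ normalForm a b x y z ↔
      w ≤ x ⊔ y ⊔ z ∧ w ≤ x ⊔ z ⊔ a ∧ w ≤ x ⊔ y ⊔ b ∧ w ≤ x ⊔ (a ⊔ b) := by
  rw [normalForm, sup_inf_left, sup_inf_left, sup_inf_right, sup_inf_right, le_inf_iff, le_inf_iff,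
    le_inf_iff, sup_right_comm x a z, sup_assoc x a b, and_assoc]

theorem inf_le_normalForm_iff [OrderBot M] {a b w x y z : M} (hab : Disjoint a b) :
    w ⊓ a ≤ normalForm a b x y z ↔ w ⊓ a ≤ x ⊔ y := by
  have hzb : a ⊓ (z ⊓ b) = ⊥ := (hab.mono_right inf_le_right).eq_bot
  have key : a ⊓ normalForm a b x y z = a ⊓ (x ⊔ y) := by
    simp only [normalForm, inf_sup_left, hzb, sup_bot_eq, inf_comm y a, ← inf_assoc, inf_idem]
  have inf_le_iff (v : M) : w ⊓ a ≤ v ↔ w ⊓ a ≤ a ⊓ v := by simp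
  rw [inf_le_iff, key, ← inf_le_iff]

theorem inf_right_le_normalForm_iff [OrderBot M] {a b w x y z : M} (hab : Disjoint a b) :
    w ⊓ b ≤ normalForm a b x y z ↔ w ⊓ b ≤ x ⊔ z := by
  rw [← normalForm_swap, inf_le_normalForm_iff hab.symm]

theorem normalForm_le_iff {a b x y z w : M} :
    normalForm a b x y z ≤ w ↔ x ≤ w ∧ y ⊓ a ≤ w ∧ z ⊓ b ≤ w := by
  rw [normalForm, sup_le_iff, sup_le_iff, and_assoc]

theorem eq_top_of_normalForm_eq_top [OrderTop M] (hM : SupPrime (⊤ : M)) {a b x y z : M}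
    (ha : a ≠ ⊤) (hb : b ≠ ⊤) (h : normalForm a b x y z = ⊤) : x = ⊤ := by
  rcases hM.le_sup.mp h.ge with h | h
  · exact (hM.le_sup.mp h).elim top_le_iff.mp fun h => absurd (top_le_iff.mp (le_inf_iff.mp h).2) ha
  · exact absurd (top_le_iff.mp (le_inf_iff.mp h).2) hb

end NormalForm

section Extension

variable {E M : Type*} [DistribLattice E] [OrderBot E]

/-- The sublattice of normal forms over a sublattice `K` and two disjoint elements `p` and `n`. It
contains `p` and `n` as soon as `K` contains `⊥` and `⊤`. -/
def adjoinDisjoint (K : Sublattice E) {p n : E} (hpn : Disjoint p n) : Sublattice E where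
  carrier := {u | ∃ x y z : K, normalForm p n (x : E) y z = u}
  supClosed' := by
    rintro _ ⟨x, y, z, rfl⟩ _ ⟨x', y', z', rfl⟩
    exact ⟨x ⊔ x', y ⊔ y', z ⊔ z', (normalForm_sup ..).symm⟩
  infClosed' := by
    rintro _ ⟨x, y, z, rfl⟩ _ ⟨x', y', z', rfl⟩
    exact ⟨x ⊓ x', x ⊓ y' ⊔ y ⊓ x' ⊔ y ⊓ y', x ⊓ z' ⊔ z ⊓ x' ⊔ z ⊓ z', (normalForm_inf hpn ..).symm⟩

theorem le_adjoinDisjoint (K : Sublattice E) {p n : E} (hpn : Disjoint p n) :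
    K ≤ adjoinDisjoint K hpn :=
  fun x hx => ⟨⟨x, hx⟩, ⟨x, hx⟩, ⟨x, hx⟩, normalForm_self p n x⟩

theorem left_mem_adjoinDisjoint [OrderTop E] {K : Sublattice E} {p n : E} (hpn : Disjoint p n)
    (hbot : ⊥ ∈ K) (htop : ⊤ ∈ K) : p ∈ adjoinDisjoint K hpn :=
  ⟨⟨⊥, hbot⟩, ⟨⊤, htop⟩, ⟨⊥, hbot⟩, by simp [normalForm]⟩

theorem right_mem_adjoinDisjoint [OrderTop E] {K : Sublattice E} {p n : E} (hpn : Disjoint p n)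
    (hbot : ⊥ ∈ K) (htop : ⊤ ∈ K) : n ∈ adjoinDisjoint K hpn :=
  ⟨⟨⊥, hbot⟩, ⟨⊥, hbot⟩, ⟨⊤, htop⟩, by simp [normalForm]⟩

variable [DistribLattice M] [OrderBot M] {K : Sublattice E}

/-- The pair `(a, b)` is a possible value at the pair `(p, n)` of an extension of `f` to the
sublattice generated by `K`, `p` and `n`: it satisfies all the inequalities that such an extension
forces upon it. -/
structure IsCompatible (f : LatticeHom K M) (p n : E) (a b : M) : Prop where
  disjoint : Disjoint a b
  map_le_left : ∀ x y : K, (x : E) ≤ (y : E) ⊔ p → f x ≤ f y ⊔ a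
  map_le_right : ∀ x y : K, (x : E) ≤ (y : E) ⊔ n → f x ≤ f y ⊔ b
  map_le_sup : ∀ x y : K, (x : E) ≤ (y : E) ⊔ (p ⊔ n) → f x ≤ f y ⊔ (a ⊔ b)
  inf_left_le : ∀ x y : K, (x : E) ⊓ p ≤ y → f x ⊓ a ≤ f y
  inf_right_le : ∀ x y : K, (x : E) ⊓ n ≤ y → f x ⊓ b ≤ f y

namespace IsCompatible

variable {f : LatticeHom K M} {p n : E} {a b : M}

theorem normalForm_le_normalForm (h : IsCompatible f p n a b) (hpn : Disjoint p n)
    {x y z x' y' z' : K} (hle : normalForm p n (x : E) y z ≤ normalForm p n (x' : E) y' z') :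
    normalForm a b (f x) (f y) (f z) ≤ normalForm a b (f x') (f y') (f z') := by
  simp only [normalForm_le_iff, le_normalForm_iff (w := f x), le_normalForm_iff (w := (x : E)),
    inf_le_normalForm_iff hpn, inf_right_le_normalForm_iff hpn, inf_le_normalForm_iff h.disjoint,
    inf_right_le_normalForm_iff h.disjoint, ← map_sup] at hle ⊢
  obtain ⟨⟨hx, hxp, hxn, hxpn⟩, hy, hz⟩ := hle
  exact ⟨⟨OrderHomClass.mono f hx, h.map_le_left _ _ hxp, h.map_le_right _ _ hxn,
    h.map_le_sup _ _ hxpn⟩, h.inf_left_le _ _ hy, h.inf_right_le _ _ hz⟩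

theorem exists_extension (h : IsCompatible f p n a b) (hpn : Disjoint p n) :
    ∃ g : LatticeHom (adjoinDisjoint K hpn) M, ∀ (x y z : K) (u : adjoinDisjoint K hpn),
      normalForm p n (x : E) y z = u → g u = normalForm a b (f x) (f y) (f z) := by
  choose x y z hxyz using fun u : adjoinDisjoint K hpn => u.2
  have well_defined (x' y' z' : K) (u : adjoinDisjoint K hpn)
      (hu : normalForm p n (x' : E) y' z' = u) :
      normalForm a b (f (x u)) (f (y u)) (f (z u)) = normalForm a b (f x') (f y') (f z') :=
    le_antisymm (h.normalForm_le_normalForm hpn (hxyz u |>.trans hu.symm).le)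
      (h.normalForm_le_normalForm hpn (hxyz u |>.trans hu.symm).ge)
  refine ⟨⟨⟨fun u => normalForm a b (f (x u)) (f (y u)) (f (z u)), fun u v => ?_⟩, fun u v => ?_⟩,
    well_defined⟩
  · simp only [normalForm_sup, ← map_sup]
    refine well_defined _ _ _ _ ?_
    simp only [Sublattice.coe_sup, ← normalForm_sup, hxyz]
  · simp only [normalForm_inf h.disjoint, ← map_sup, ← map_inf]
    refine well_defined _ _ _ _ ?_
    simp only [Sublattice.coe_sup, Sublattice.coe_inf, ← normalForm_inf hpn, hxyz]

end IsCompatible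

end Extension

section Consonance

variable {M ι κ : Type*} [DistribLattice M] [OrderTop M]

theorem le_inf_finsetInf_sup {T : Finset κ} {x y : M} {u x' : κ → M}
    (hu : ∀ j ∈ T, x ≤ u j ⊔ x' j) (hy : ∀ j ∈ T, x ⊓ x' j ≤ y) : x ≤ x ⊓ T.inf u ⊔ y := by
  rw [sup_inf_right, Finset.inf_sup_distrib_right]
  refine le_inf le_sup_left (Finset.le_inf fun j hj => ?_)
  calc x ≤ x ⊓ (u j ⊔ x' j) := le_inf le_rfl (hu j hj)
    _ = x ⊓ u j ⊔ x ⊓ x' j := inf_sup_left _ _ _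
    _ ≤ u j ⊔ y := sup_le_sup inf_le_right (hy j hj)

theorem exists_disjoint_of_consonant [OrderBot M] (S : Finset ι) (T : Finset κ) {x y : ι → M}
    {x' y' : κ → M}
    (hc : ∀ i ∈ S, ∀ j ∈ T, Consonant (x i) (x' j))
    (hle : ∀ i ∈ S, ∀ j ∈ T, x i ⊓ x' j ≤ y i ⊓ y' j) :
    ∃ a b : M, Disjoint a b ∧ a ≤ S.sup x ∧ b ≤ T.sup x' ∧
      (∀ i ∈ S, x i ≤ a ⊔ y i) ∧ ∀ j ∈ T, x' j ≤ b ⊔ y' j := by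
  choose! u v hu hv huv using hc
  refine ⟨S.sup fun i => x i ⊓ T.inf (u i), T.sup fun j => x' j ⊓ S.inf (v · j), ?_,
    Finset.sup_mono_fun fun _ _ => inf_le_left, Finset.sup_mono_fun fun _ _ => inf_le_left,
    fun i hi => ?_, fun j hj => ?_⟩
  · refine Finset.disjoint_sup_left.mpr fun i hi => Finset.disjoint_sup_right.mpr fun j hj => ?_
    exact (disjoint_iff.mpr (huv i hi j hj)).mono (inf_le_right.trans (Finset.inf_le hj))
      (inf_le_right.trans (Finset.inf_le (f := (v · j)) hi))
  · refine (le_inf_finsetInf_sup (hu i hi) fun j hj => (hle i hi j hj).trans inf_le_left).trans ?_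
    exact sup_le_sup_right (Finset.le_sup (f := fun i => x i ⊓ T.inf (u i)) hi) _
  · refine (le_inf_finsetInf_sup (u := (v · j)) (x' := x)
      (fun i hi => (hv i hi j hj).trans (sup_comm ..).le) fun i hi =>
        inf_comm .. |>.trans_le ((hle i hi j hj).trans inf_le_right)).trans ?_
    exact sup_le_sup_right (Finset.le_sup (f := fun j => x' j ⊓ S.inf (v · j)) hj) _

theorem CompletelyNormal.consonant_withTop {L : Type*} [Lattice L] [OrderBot L]
    (hL : CompletelyNormal L) {x y : WithTop L} (hx : x ≠ ⊤) (hy : y ≠ ⊤) : Consonant x y := by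
  lift x to L using hx
  lift y to L using hy
  obtain ⟨u, v, hu, hv, huv⟩ := hL x y
  exact ⟨u, v, mod_cast hu, mod_cast hv, by rw [← WithTop.coe_inf, huv, WithTop.coe_bot]⟩

theorem supPrime_withTop_top (L : Type*) [SemilatticeSup L] [Nonempty L] :
    SupPrime (⊤ : WithTop L) := by
  refine ⟨not_isMin_iff.mpr ⟨Classical.arbitrary L, WithTop.coe_lt_top _⟩, fun x y h => ?_⟩
  by_contra! hxy
  lift x to L using fun h => hxy.1 h.ge
  lift y to L using fun h => hxy.2 h.ge
  exact WithTop.coe_ne_top (top_le_iff.mp h)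

end Consonance

section Differences

theorem map_le_sup_of_le_sup_sdiff {E M : Type*} [GeneralizedBooleanAlgebra E] [DistribLattice M]
    {K : Sublattice E} (f : LatticeHom K M) {T : Finset (K × K)} {c : M}
    (hc : ∀ q ∈ T, f q.1 ≤ c ⊔ f q.2) {x y : K}
    (h : (x : E) ≤ (y : E) ⊔ T.sup fun q => (q.1 : E) \ q.2) : f x ≤ f y ⊔ c := by
  classical
  induction T using Finset.induction_on generalizing x y with
  | empty => exact (OrderHomClass.mono f (show x ≤ y by simpa using h)).trans le_sup_left
  | insert q T _ ih =>
    rw [Finset.sup_insert] at h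
    specialize @ih fun r hr => hc r (Finset.mem_insert_of_mem hr)
    have hinf : f (x ⊓ q.2) ≤ f y ⊔ c := by
      refine ih ?_
      calc (x : E) ⊓ q.2 ≤ ((y : E) ⊔ (q.1 \ q.2 ⊔ T.sup fun q => (q.1 : E) \ q.2)) ⊓ q.2 :=
            inf_le_inf_right _ h
        _ = ((y : E) ⊔ T.sup fun q => (q.1 : E) \ q.2) ⊓ q.2 := by
            rw [sup_left_comm, inf_sup_right, inf_sdiff_self_left, bot_sup_eq]
        _ ≤ _ := inf_le_left
    have hsup : f x ≤ f (y ⊔ q.1) ⊔ c := by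
      refine ih (h.trans ?_)
      rw [Sublattice.coe_sup, sup_assoc]
      gcongr
      exact sdiff_le
    rw [map_inf] at hinf
    rw [map_sup] at hsup
    refine le_of_inf_le_sup_le (z := f q.2) (le_inf hinf inf_le_right) (sup_le ?_ le_sup_right)
    calc f x ≤ f y ⊔ f q.1 ⊔ c := hsup
      _ ≤ f y ⊔ (c ⊔ f q.2) ⊔ c := by gcongr; exact hc q (Finset.mem_insert_self _ _)
      _ = f y ⊔ c ⊔ f q.2 := by rw [sup_assoc, sup_right_comm, sup_idem, sup_assoc]

end Differences

section SignEquiv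

variable {Ω 𝕜 : Type*} [Zero 𝕜] [LinearOrder 𝕜] {F F₀ : Set (Ω → 𝕜)} {e : Ω → 𝕜} {s : SignType}
  {x y z : Ω} {X Y : Set Ω}

/-- Two points are sign equivalent with respect to a set `F` of functions if every function in `F`
takes values of the same sign at both. The classes are the cells of the arrangement `F`. -/
def SignEquiv (F : Set (Ω → 𝕜)) (x y : Ω) : Prop :=
  ∀ d ∈ F, sign (d x) = sign (d y)

namespace SignEquiv

theorem refl (F : Set (Ω → 𝕜)) (x : Ω) : SignEquiv F x x := fun _ _ => rfl

theorem symm (h : SignEquiv F x y) : SignEquiv F y x := fun d hd => (h d hd).symm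

theorem trans (h : SignEquiv F x y) (h' : SignEquiv F y z) : SignEquiv F x z :=
  fun d hd => (h d hd).trans (h' d hd)

theorem mono (hF : F₀ ⊆ F) (h : SignEquiv F x y) : SignEquiv F₀ x y := fun d hd => h d (hF hd)

end SignEquiv

theorem exists_finset_signEquiv (hF : F.Finite) (C : Set Ω) :
    ∃ S : Finset Ω, ↑S ⊆ C ∧ ∀ z ∈ C, ∃ w ∈ S, SignEquiv F z w := by
  classical
  have := hF.to_subtype
  let signVector (z : Ω) (d : F) : SignType := sign (d.1 z)
  obtain ⟨S, hSC, hS⟩ := Finset.subset_set_image_iff.mp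
    (Set.toFinite (signVector '' C)).coe_toFinset.subset
  refine ⟨S, hSC, fun z hz => ?_⟩
  have hzS : signVector z ∈ S.image signVector := by
    rw [hS, Set.Finite.mem_toFinset]
    exact Set.mem_image_of_mem _ hz
  obtain ⟨w, hw, hwz⟩ := Finset.mem_image.mp hzS
  exact ⟨w, hw, fun d hd => (congrFun hwz ⟨d, hd⟩).symm⟩

theorem setOf_pos_mem_Op {d : Ω → 𝕜} (hd : d ∈ F) : {x | 0 < d x} ∈ Op F :=
  Or.inl (subset_latticeClosure ⟨d, hd, Or.inl rfl⟩)

theorem setOf_neg_mem_Op {d : Ω → 𝕜} (hd : d ∈ F) : {x | d x < 0} ∈ Op F :=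
  Or.inl (subset_latticeClosure ⟨d, hd, Or.inr rfl⟩)

theorem disjoint_setOf_pos_setOf_neg (e : Ω → 𝕜) : Disjoint {x | 0 < e x} {x | e x < 0} :=
  Set.disjoint_left.mpr fun _ hpos hneg => lt_asymm hpos hneg

theorem empty_mem_Op (hF : F.Nonempty) : ∅ ∈ Op F := by
  obtain ⟨d, hd⟩ := hF
  rw [← Set.bot_eq_empty, ← (disjoint_setOf_pos_setOf_neg d).eq_bot]
  exact (Op F).infClosed (setOf_pos_mem_Op hd) (setOf_neg_mem_Op hd)

theorem Op_le {K : Sublattice (Set Ω)} (huniv : Set.univ ∈ K) (hpos : ∀ d ∈ F, {x | 0 < d x} ∈ K)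
    (hneg : ∀ d ∈ F, {x | d x < 0} ∈ K) : Op F ≤ K := by
  rintro X (hX | rfl)
  · refine latticeClosure_min ?_ K.isSublattice hX
    rintro _ ⟨d, hd, rfl | rfl⟩
    exacts [hpos d hd, hneg d hd]
  · exact huniv

theorem Op_insert_le (hF : F.Nonempty) (e : Ω → 𝕜) :
    Op (insert e F) ≤ adjoinDisjoint (Op F) (disjoint_setOf_pos_setOf_neg e) := by
  have hle := le_adjoinDisjoint (Op F) (disjoint_setOf_pos_setOf_neg e)
  refine Op_le (hle (univ_mem_Op F)) ?_ ?_
  · rintro d (rfl | hd)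
    exacts [left_mem_adjoinDisjoint _ (empty_mem_Op hF) (univ_mem_Op F), hle (setOf_pos_mem_Op hd)]
  · rintro d (rfl | hd)
    exacts [right_mem_adjoinDisjoint _ (empty_mem_Op hF) (univ_mem_Op F), hle (setOf_neg_mem_Op hd)]

theorem SignEquiv.mem_iff (h : SignEquiv F x y) (hX : X ∈ Op F) : x ∈ X ↔ y ∈ X := by
  let K : Sublattice (Set Ω) :=
    { carrier := {X | x ∈ X ↔ y ∈ X}
      supClosed' := fun X hX Y hY => or_congr hX hY
      infClosed' := fun X hX Y hY => and_congr hX hY }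
  have hK : Op F ≤ K := Op_le (K := K) (iff_of_true trivial trivial)
    (fun d hd => show 0 < d x ↔ 0 < d y by rw [← sign_eq_one_iff, h d hd, sign_eq_one_iff])
    (fun d hd => show d x < 0 ↔ d y < 0 by rw [← sign_eq_neg_one_iff, h d hd, sign_eq_neg_one_iff])
  exact hK hX

/-- The union of the cells of `F` on which `e` has constant sign `s`. -/
def signCore (F : Set (Ω → 𝕜)) (e : Ω → 𝕜) (s : SignType) : Set Ω :=
  {x | ∀ y, SignEquiv F y x → sign (e y) = s}

/-- The union of the cells of `F` on which `e` takes the sign `s` somewhere. -/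
def signHull (F : Set (Ω → 𝕜)) (e : Ω → 𝕜) (s : SignType) : Set Ω :=
  {x | ∃ y, SignEquiv F y x ∧ sign (e y) = s}

theorem sign_eq_of_mem_signCore (hx : x ∈ signCore F e s) : sign (e x) = s :=
  hx x (SignEquiv.refl F x)

theorem disjoint_signCore_signHull {t : SignType} (hst : s ≠ t) :
    Disjoint (signCore F e s) (signHull F e t) :=
  Set.disjoint_left.mpr fun _ hs ⟨y, hyx, hy⟩ => hst ((hs y hyx).symm.trans hy)

theorem subset_union_signCore (hX : X ∈ Op F) (hY : Y ∈ Op F)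
    (h : X ⊆ Y ∪ {x | sign (e x) = s}) : X ⊆ Y ∪ signCore F e s := by
  refine fun x hx => or_iff_not_imp_left.mpr fun hxY y hyx => ?_
  exact (h ((hyx.mem_iff hX).mpr hx)).resolve_left fun hy => hxY ((hyx.mem_iff hY).mp hy)

theorem inter_signHull_subset (hX : X ∈ Op F) (hY : Y ∈ Op F)
    (h : X ∩ {x | sign (e x) = s} ⊆ Y) : X ∩ signHull F e s ⊆ Y := by
  rintro x ⟨hx, y, hyx, hy⟩
  exact (hyx.mem_iff hY).mp (h ⟨(hyx.mem_iff hX).mpr hx, hy⟩)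

/-- `F₀` controls the signs of `e` over `F` if every sign that `e` takes on a cell of `F₀` is taken
on each cell of `F` inside it (for `F₀ ⊆ F`). -/
def Controls (F₀ F : Set (Ω → 𝕜)) (e : Ω → 𝕜) : Prop :=
  ∀ x y, SignEquiv F₀ x y → ∃ x', SignEquiv F x' x ∧ sign (e x') = sign (e y)

theorem Controls.mem_signCore (hF : Controls F₀ F e) (hF₀ : F₀ ⊆ F) (hz : z ∈ signCore F e s)
    (hxz : SignEquiv F₀ x z) : x ∈ signCore F e s := by
  intro y hyx
  obtain ⟨z', hz'z, hz'⟩ := hF z y ((hyx.mono hF₀).trans hxz).symm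
  rw [← hz', hz z' hz'z]

end SignEquiv

section OpenStar

variable {Ω 𝕜 : Type*} [Zero 𝕜] [LinearOrder 𝕜] {F F₀ : Set (Ω → 𝕜)} {x z : Ω}

/-- The open star of the cell of `z` in the arrangement `F`: the union of the cells whose closure
contains `z`, if `F` consists of linear functionals. -/
def openStar (F : Set (Ω → 𝕜)) (z : Ω) : Set Ω :=
  {x | ∀ d ∈ F, d z ≠ 0 → sign (d x) = sign (d z)}

/-- The open star of the cell of `z` with that cell removed; see `openStar_sdiff_puncturedStar`. -/
def puncturedStar (F : Set (Ω → 𝕜)) (z : Ω) : Set Ω :=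
  openStar F z ∩ {x | ∃ d ∈ F, d z = 0 ∧ d x ≠ 0}

theorem openStar_sdiff_puncturedStar (F : Set (Ω → 𝕜)) (z : Ω) :
    openStar F z \ puncturedStar F z = {x | SignEquiv F x z} := by
  ext x
  refine ⟨fun ⟨hx, hx'⟩ d hd => ?_, fun hx => ⟨fun d hd _ => hx d hd, ?_⟩⟩
  · by_cases hz : d z = 0
    · have hdx : d x = 0 := by
        by_contra hdx
        exact hx' ⟨hx, d, hd, hz, hdx⟩
      rw [hdx, hz]
    · exact hx d hd hz
  · rintro ⟨-, d, hd, hz, hdx⟩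
    exact hdx (sign_eq_zero_iff.mp (by rw [hx d hd, hz, sign_zero]))

theorem openStar_mem_Op (hfin : F₀.Finite) (hF₀ : F₀ ⊆ F) (z : Ω) : openStar F₀ z ∈ Op F := by
  have hstar : openStar F₀ z = ⨅ d ∈ F₀, {x | d z ≠ 0 → sign (d x) = sign (d z)} := by
    ext x
    simp [openStar]
  rw [hstar]
  refine (Op F).infClosed.biInf_mem hfin (univ_mem_Op F) fun d hd => ?_
  rcases lt_trichotomy (d z) 0 with hz | hz | hz
  · simpa [hz, hz.ne, sign_eq_neg_one_iff] using setOf_neg_mem_Op (hF₀ hd)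
  · simpa [hz] using univ_mem_Op F
  · simpa [hz, hz.ne', sign_eq_one_iff] using setOf_pos_mem_Op (hF₀ hd)

theorem puncturedStar_mem_Op (hne : F.Nonempty) (hfin : F₀.Finite) (hF₀ : F₀ ⊆ F) (z : Ω) :
    puncturedStar F₀ z ∈ Op F := by
  refine (Op F).infClosed (openStar_mem_Op hfin hF₀ z) ?_
  have hunion : {x | ∃ d ∈ F₀, d z = 0 ∧ d x ≠ 0} =
      ⨆ d ∈ {d ∈ F₀ | d z = 0}, ({x | d x < 0} ⊔ {x | 0 < d x}) := by
    ext x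
    simp [lt_or_lt_iff_ne, and_assoc]
  rw [hunion]
  exact (Op F).supClosed.biSup_mem (hfin.subset (Set.sep_subset _ _)) (empty_mem_Op hne)
    fun d hd => (Op F).supClosed (setOf_neg_mem_Op (hF₀ hd.1)) (setOf_pos_mem_Op (hF₀ hd.1))

end OpenStar

section CoreDecomposition

variable {Ω 𝕜 M : Type*} [Zero 𝕜] [LinearOrder 𝕜] [DistribLattice M] {F : Set (Ω → 𝕜)}
  {e : Ω → 𝕜} {s t : SignType} {T T' : Finset (Op F × Op F)} {X Y : Op F} {c : M}

/-- A finite family of pairs in `Op F` whose differences cover exactly the points where the sign of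
`e` is forced to be `s`, with first components that are proper and consist of points where the sign
of `e` may be `s`. It translates inclusions involving `{x | sign (e x) = s}` into inequalities
between elements of `Op F`. -/
structure IsCoreDecomposition (F : Set (Ω → 𝕜)) (e : Ω → 𝕜) (s : SignType)
    (T : Finset (Op F × Op F)) : Prop where
  ne_univ : ∀ q ∈ T, (q.1 : Set Ω) ≠ Set.univ
  subset_signHull : ∀ q ∈ T, (q.1 : Set Ω) ⊆ signHull F e s
  sup_sdiff_eq : (T.sup fun q => (q.1 : Set Ω) \ q.2) = signCore F e s

namespace IsCoreDecomposition

theorem inf_le_snd (hT : IsCoreDecomposition F e s T) (hT' : IsCoreDecomposition F e t T')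
    (hst : s ≠ t) {q r : Op F × Op F} (hq : q ∈ T) (hr : r ∈ T') : q.1 ⊓ r.1 ≤ q.2 := by
  rintro x ⟨hxq, hxr⟩
  by_contra hx
  have hcore : (q.1 : Set Ω) \ q.2 ⊆ signCore F e s := by
    rw [← hT.sup_sdiff_eq]
    exact Finset.le_sup (f := fun q : Op F × Op F => (q.1 : Set Ω) \ q.2) hq
  exact (disjoint_signCore_signHull hst).le_bot ⟨hcore ⟨hxq, hx⟩, hT'.subset_signHull r hr hxr⟩

theorem map_le_sup (hT : IsCoreDecomposition F e s T) (f : LatticeHom (Op F) M)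
    (hc : ∀ q ∈ T, f q.1 ≤ c ⊔ f q.2) (h : (X : Set Ω) ⊆ Y ∪ {x | sign (e x) = s}) :
    f X ≤ f Y ⊔ c := by
  refine map_le_sup_of_le_sup_sdiff f hc ?_
  rw [hT.sup_sdiff_eq]
  exact subset_union_signCore X.2 Y.2 h

variable [OrderBot M]

theorem map_inf_le (hT : IsCoreDecomposition F e s T) (f : LatticeHom (Op F) M)
    (hc : c ≤ T.sup fun q => f q.1) (h : (X : Set Ω) ∩ {x | sign (e x) = s} ⊆ Y) :
    f X ⊓ c ≤ f Y := by
  have map_inf_fst_le : ∀ q ∈ T, f X ⊓ f q.1 ≤ f Y := fun q hq => by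
    rw [← map_inf]
    exact OrderHomClass.mono f <| (Set.inter_subset_inter_right X (hT.subset_signHull q hq)).trans
      (inter_signHull_subset X.2 Y.2 h)
  calc f X ⊓ c ≤ f X ⊓ T.sup fun q => f q.1 := inf_le_inf_left _ hc
    _ = T.sup fun q => f X ⊓ f q.1 := Finset.sup_inf_distrib_left ..
    _ ≤ f Y := Finset.sup_le map_inf_fst_le

theorem ne_top_of_le_sup [OrderTop M] (hM : SupPrime (⊤ : M)) (hT : IsCoreDecomposition F e s T)
    {f : Op F → M} (hf : ∀ X, f X = ⊤ → (X : Set Ω) = Set.univ)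
    (hc : c ≤ T.sup fun q => f q.1) : c ≠ ⊤ := by
  rintro rfl
  obtain ⟨q, hq, hle⟩ := hM.le_finset_sup.mp hc
  exact hT.ne_univ q hq (hf q.1 (top_le_iff.mp hle))

end IsCoreDecomposition

end CoreDecomposition

section Linear

open Filter MulOpposite

theorem sign_add_eq_left_of_abs_lt {A : Type*} [AddCommGroup A] [LinearOrder A]
    [IsOrderedAddMonoid A] {p q : A} (h : |q| < |p|) : sign (p + q) = sign p := by
  rcases lt_trichotomy p 0 with hp | rfl | hp
  · rw [abs_of_neg hp] at h
    rw [sign_neg hp, sign_neg (lt_neg_iff_add_neg'.mp (abs_lt.mp h).2)]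
  · exact absurd h (by simp)
  · rw [abs_of_pos hp] at h
    rw [sign_pos hp, sign_pos (neg_lt_iff_pos_add'.mp (abs_lt.mp h).1)]

theorem sign_mul_add_mul_eq {R : Type*} [Ring R] [LinearOrder R] [IsStrictOrderedRing R]
    {a b s t : R} (hab : sign a = sign b) (hs : 0 < s) (ht : 0 < t) :
    sign (a * s + b * t) = sign a := by
  rcases lt_trichotomy a 0 with ha | rfl | ha
  · rw [sign_neg ha, eq_comm, sign_eq_neg_one_iff] at hab
    rw [sign_neg ha, sign_neg (add_neg (mul_neg_of_neg_of_pos ha hs)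
      (mul_neg_of_neg_of_pos hab ht))]
  · rw [sign_zero, eq_comm, sign_eq_zero_iff] at hab
    simp [hab]
  · rw [sign_pos ha, eq_comm, sign_eq_one_iff] at hab
    rw [sign_pos ha, sign_pos (add_pos (mul_pos ha hs) (mul_pos hab ht))]

variable {𝕜 V : Type*} [DivisionRing 𝕜] [LinearOrder 𝕜] [IsStrictOrderedRing 𝕜]

theorem eventually_sign_add_mul_eq {p : 𝕜} (hp : p ≠ 0) (q : 𝕜) :
    ∀ᶠ δ : Set.Ioi (0 : 𝕜) in atBot, sign (p + q * δ) = sign p := by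
  have hq : 0 < |q| + 1 := by positivity
  have hp' : 0 < |p| := abs_pos.mpr hp
  filter_upwards [eventually_le_atBot ⟨(|q| + 1)⁻¹ * |p|, mul_pos (inv_pos.mpr hq) hp'⟩]
    with ⟨δ, hδ⟩ hle
  refine sign_add_eq_left_of_abs_lt ?_
  calc |q * δ| = |q| * δ := by rw [abs_mul, abs_of_pos hδ]
    _ < (|q| + 1) * δ := mul_lt_mul_of_pos_right (lt_add_one _) hδ
    _ ≤ (|q| + 1) * ((|q| + 1)⁻¹ * |p|) := mul_le_mul_of_nonneg_left hle hq.le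
    _ = |p| := mul_inv_cancel_left₀ hq.ne' _

variable [AddCommMonoid V] [Module 𝕜ᵐᵒᵖ V] {F F₀ : Set (V → 𝕜)} {e : V → 𝕜} {s : SignType}
  {x y z : V}

theorem exists_signEquiv_of_mem_openStar (hfin : F₀.Finite)
    (hlin : ∀ d ∈ F₀, IsLinearMap 𝕜ᵐᵒᵖ d) (he : IsLinearMap 𝕜ᵐᵒᵖ e) (hx : x ∈ openStar F₀ z)
    (hez : e z ≠ 0) : ∃ y, SignEquiv F₀ x y ∧ sign (e y) = sign (e z) := by
  have apply_perturb {d : V → 𝕜} (hd : IsLinearMap 𝕜ᵐᵒᵖ d) (δ : 𝕜) :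
      d (z + op δ • x) = d z + d x * δ := by
    rw [hd.map_add, hd.map_smul, op_smul_eq_mul]
  have eventually_sign_eq : ∀ d ∈ insert e F₀, ∀ᶠ δ : Set.Ioi (0 : 𝕜) in atBot,
      d z ≠ 0 → sign (d (z + op (δ : 𝕜) • x)) = sign (d z) := by
    refine fun d hd => eventually_imp_distrib_left.mpr fun hdz => ?_
    have hd : IsLinearMap 𝕜ᵐᵒᵖ d := by
      rcases hd with rfl | hd
      exacts [he, hlin d hd]
    simpa only [apply_perturb hd] using eventually_sign_add_mul_eq hdz (d x)
  obtain ⟨⟨δ, hδ⟩, hsign⟩ :=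
    ((eventually_all_finite (hfin.insert e)).mpr eventually_sign_eq).exists
  refine ⟨z + op δ • x, fun d hd => ?_, hsign e (Set.mem_insert _ _) hez⟩
  by_cases hdz : d z = 0
  · rw [apply_perturb (hlin d hd), hdz, zero_add, sign_mul, sign_pos hδ, mul_one]
  · rw [hx d hd hdz, hsign d (Set.mem_insert_of_mem _ hd) hdz]

theorem openStar_subset_signHull (hfin : F₀.Finite) (hlin : ∀ d ∈ F₀, IsLinearMap 𝕜ᵐᵒᵖ d)
    (he : IsLinearMap 𝕜ᵐᵒᵖ e) (hctrl : Controls F₀ F e) (hz : sign (e z) = s) (hs : s ≠ 0) :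
    openStar F₀ z ⊆ signHull F e s := by
  intro x hx
  obtain ⟨y, hxy, hy⟩ := exists_signEquiv_of_mem_openStar hfin hlin he hx
    (by rwa [← sign_ne_zero, hz])
  obtain ⟨x', hx', hsign⟩ := hctrl x y hxy
  exact ⟨x', hx', hsign.trans (hy.trans hz)⟩

theorem exists_signEquiv_eq_zero (hlin : ∀ d ∈ F, IsLinearMap 𝕜ᵐᵒᵖ d) (he : IsLinearMap 𝕜ᵐᵒᵖ e)
    (hxy : SignEquiv F x y) (hx : e x < 0) (hy : 0 < e y) : ∃ z, SignEquiv F z x ∧ e z = 0 := by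
  have apply_combination {d : V → 𝕜} (hd : IsLinearMap 𝕜ᵐᵒᵖ d) (a b : 𝕜) :
      d (op a • x + op b • y) = d x * a + d y * b := by
    rw [hd.map_add, hd.map_smul, hd.map_smul, op_smul_eq_mul, op_smul_eq_mul]
  refine ⟨op (-e x)⁻¹ • x + op (e y)⁻¹ • y, fun d hd => ?_, ?_⟩
  · rw [apply_combination (hlin d hd), sign_mul_add_mul_eq (hxy d hd)
      (inv_pos.mpr (neg_pos.mpr hx)) (inv_pos.mpr hy)]
  · rw [apply_combination he, inv_neg, mul_neg, mul_inv_cancel₀ hx.ne, mul_inv_cancel₀ hy.ne',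
      neg_add_cancel]

theorem mem_signCore_sign (hlin : ∀ d ∈ F, IsLinearMap 𝕜ᵐᵒᵖ d) (he : IsLinearMap 𝕜ᵐᵒᵖ e)
    (hne : ∀ y, SignEquiv F y x → e y ≠ 0) : x ∈ signCore F e (sign (e x)) := by
  intro y hyx
  rcases (hne x (.refl F x)).lt_or_gt with hx | hx <;> rcases (hne y hyx).lt_or_gt with hy | hy
  · rw [sign_neg hx, sign_neg hy]
  · obtain ⟨z, hzx, hz⟩ := exists_signEquiv_eq_zero hlin he hyx.symm hx hy
    exact absurd hz (hne z hzx)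
  · obtain ⟨z, hzy, hz⟩ := exists_signEquiv_eq_zero hlin he hyx hy hx
    exact absurd hz (hne z (hzy.trans hyx))
  · rw [sign_pos hx, sign_pos hy]

theorem subset_union_signCore_union_signCore (hlin : ∀ d ∈ F, IsLinearMap 𝕜ᵐᵒᵖ d)
    (he : IsLinearMap 𝕜ᵐᵒᵖ e) {X Y : Set V} (hX : X ∈ Op F) (hY : Y ∈ Op F)
    (h : X ⊆ Y ∪ ({x | 0 < e x} ∪ {x | e x < 0})) :
    X ⊆ Y ∪ (signCore F e 1 ∪ signCore F e (-1)) := by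
  refine fun x hx => or_iff_not_imp_left.mpr fun hxY => ?_
  have hne (y : V) (hyx : SignEquiv F y x) : e y ≠ 0 := by
    rcases h ((hyx.mem_iff hX).mpr hx) with hy | hy | hy
    exacts [absurd ((hyx.mem_iff hY).mp hy) hxY, ne_of_gt hy, ne_of_lt hy]
  have hmem := mem_signCore_sign hlin he hne
  rcases (hne x (.refl F x)).lt_or_gt with hex | hex
  · exact Or.inr (sign_neg hex ▸ hmem)
  · exact Or.inl (sign_pos hex ▸ hmem)

theorem exists_isCoreDecomposition (hF : F.Nonempty) (hlin : ∀ d ∈ F, IsLinearMap 𝕜ᵐᵒᵖ d)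
    (he : IsLinearMap 𝕜ᵐᵒᵖ e) (hF₀ : F₀ ⊆ F) (hfin : F₀.Finite) (hctrl : Controls F₀ F e)
    (hs : s ≠ 0) : ∃ T, IsCoreDecomposition F e s T := by
  classical
  have hlin₀ : ∀ d ∈ F₀, IsLinearMap 𝕜ᵐᵒᵖ d := fun d hd => hlin d (hF₀ hd)
  have zero_notMem_signCore : (0 : V) ∉ signCore F e s := fun h0 =>
    hs (by rw [← sign_eq_of_mem_signCore h0, he.map_zero, sign_zero])
  have cell_subset_signCore {z : V} (hz : z ∈ signCore F e s) :
      openStar F₀ z \ puncturedStar F₀ z ⊆ signCore F e s := by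
    rw [openStar_sdiff_puncturedStar]
    exact fun x hxz => hctrl.mem_signCore hF₀ hz hxz
  obtain ⟨S, hS, hcover⟩ := exists_finset_signEquiv hfin (signCore F e s)
  refine ⟨S.image fun z => (⟨openStar F₀ z, openStar_mem_Op hfin hF₀ z⟩,
    ⟨puncturedStar F₀ z, puncturedStar_mem_Op hF hfin hF₀ z⟩), ?_, ?_, ?_⟩
  · refine Finset.forall_mem_image.mpr fun z hz huniv => ?_
    refine zero_notMem_signCore (cell_subset_signCore (hS hz) ⟨?_, ?_⟩)
    · exact (Set.ext_iff.mp huniv 0).mpr trivial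
    · rintro ⟨-, d, hd, -, hd0⟩
      exact hd0 (hlin₀ d hd).map_zero
  · exact Finset.forall_mem_image.mpr fun z hz =>
      openStar_subset_signHull hfin hlin₀ he hctrl (sign_eq_of_mem_signCore (hS hz)) hs
  · rw [Finset.sup_image]
    refine subset_antisymm (Finset.sup_le fun z hz => cell_subset_signCore (hS hz)) fun x hx => ?_
    obtain ⟨z, hz, hxz⟩ := hcover x hx
    exact Set.mem_of_mem_of_subset ((openStar_sdiff_puncturedStar F₀ z).ge hxz)
      (Finset.le_sup (f := fun z => openStar F₀ z \ puncturedStar F₀ z) hz)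

end Linear

section Extension

variable {𝕜 V L : Type*} [DivisionRing 𝕜] [LinearOrder 𝕜] [IsStrictOrderedRing 𝕜]
  [AddCommMonoid V] [Module 𝕜ᵐᵒᵖ V] [DistribLattice L] [OrderBot L] {F F₀ G : Set (V → 𝕜)}
  {e : V → 𝕜}

theorem exists_isCompatible (hL : CompletelyNormal L) (hF : F.Nonempty)
    (hlin : ∀ d ∈ F, IsLinearMap 𝕜ᵐᵒᵖ d) (he : IsLinearMap 𝕜ᵐᵒᵖ e) (hF₀ : F₀ ⊆ F)
    (hfin : F₀.Finite) (hctrl : Controls F₀ F e) (f : LatticeHom (Op F) (WithTop L))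
    (hf : ∀ X, f X = ⊤ → (X : Set V) = Set.univ) :
    ∃ a b : WithTop L, a ≠ ⊤ ∧ b ≠ ⊤ ∧ IsCompatible f {x | 0 < e x} {x | e x < 0} a b := by
  classical
  obtain ⟨P, hP⟩ :=
    exists_isCoreDecomposition hF hlin he hF₀ hfin hctrl (show (1 : SignType) ≠ 0 by decide)
  obtain ⟨N, hN⟩ :=
    exists_isCoreDecomposition hF hlin he hF₀ hfin hctrl (show (-1 : SignType) ≠ 0 by decide)
  have inf_le_inf {q r : Op F × Op F} (hq : q ∈ P) (hr : r ∈ N) : q.1 ⊓ r.1 ≤ q.2 ⊓ r.2 :=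
    le_inf (hP.inf_le_snd hN (by decide) hq hr)
      ((inf_comm ..).trans_le (hN.inf_le_snd hP (by decide) hr hq))
  obtain ⟨a, b, hab, haP, hbN, hPa, hNb⟩ := exists_disjoint_of_consonant P N
    (x := fun q => f q.1) (y := fun q => f q.2) (x' := fun q => f q.1) (y' := fun q => f q.2)
    (fun q hq r hr => hL.consonant_withTop (mt (hf q.1) (hP.ne_univ q hq))
      (mt (hf r.1) (hN.ne_univ r hr)))
    (fun q hq r hr => by simpa only [map_inf] using OrderHomClass.mono f (inf_le_inf hq hr))
  have htop := supPrime_withTop_top L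
  refine ⟨a, b, hP.ne_top_of_le_sup htop hf haP, hN.ne_top_of_le_sup htop hf hbN, ?_⟩
  have map_le_sup (X Y : Op F) (h : (X : Set V) ≤ (Y : Set V) ⊔ ({x | 0 < e x} ⊔ {x | e x < 0})) :
      f X ≤ f Y ⊔ (a ⊔ b) := by
    refine map_le_sup_of_le_sup_sdiff f (T := P ∪ N) (fun q hq => ?_) ?_
    · rcases Finset.mem_union.mp hq with hq | hq
      · exact (hPa q hq).trans (sup_le_sup_right le_sup_left _)
      · exact (hNb q hq).trans (sup_le_sup_right le_sup_right _)
    · rw [Finset.sup_union, hP.sup_sdiff_eq, hN.sup_sdiff_eq]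
      exact subset_union_signCore_union_signCore hlin he X.2 Y.2 h
  simp only [← sign_eq_one_iff, ← sign_eq_neg_one_iff] at map_le_sup ⊢
  exact ⟨hab, fun _ _ => hP.map_le_sup f hPa, fun _ _ => hN.map_le_sup f hNb, map_le_sup,
    fun _ _ => hP.map_inf_le f haP, fun _ _ => hN.map_inf_le f hbN⟩

theorem exists_extension_of_controls (hL : CompletelyNormal L) (hF : F.Nonempty)
    (hlin : ∀ d ∈ F, IsLinearMap 𝕜ᵐᵒᵖ d) (he : IsLinearMap 𝕜ᵐᵒᵖ e) (hF₀ : F₀ ⊆ F)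
    (hfin : F₀.Finite) (hctrl : Controls F₀ F e) (hG : G = insert e F)
    (f : LatticeHom (Op F) (WithTop L)) (hf : ∀ X, f X = ⊤ ↔ (X : Set V) = Set.univ) :
    ∃ g : LatticeHom (Op G) (WithTop L), (∀ (X : Op F) (Y : Op G), (X : Set V) = Y → g Y = f X) ∧
      ∀ Y, g Y = ⊤ ↔ (Y : Set V) = Set.univ := by
  subst hG
  obtain ⟨a, b, ha, hb, hab⟩ :=
    exists_isCompatible hL hF hlin he hF₀ hfin hctrl f fun X => (hf X).mp
  obtain ⟨g, hg⟩ := hab.exists_extension (disjoint_setOf_pos_setOf_neg e)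
  let g' : LatticeHom (Op (insert e F)) (WithTop L) :=
    g.comp (Sublattice.inclusion (Op_insert_le hF e))
  have g'_extends (X : Op F) (Y : Op (insert e F)) (h : (X : Set V) = Y) : g' Y = f X :=
    (hg X X X _ ((normalForm_self _ _ _).trans h)).trans (normalForm_self _ _ _)
  refine ⟨g', g'_extends, fun Y => ⟨fun hY => ?_, fun hY => ?_⟩⟩
  · obtain ⟨x, y, z, hxyz⟩ := Op_insert_le hF e Y.2
    have hx : f x = ⊤ := eq_top_of_normalForm_eq_top (supPrime_withTop_top L) ha hb
      ((hg x y z _ hxyz).symm.trans hY)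
    exact top_le_iff.mp (((hf x).mp hx).ge.trans ((normalForm_le_iff.mp hxyz.le).1))
  · exact (g'_extends ⟨Set.univ, univ_mem_Op F⟩ Y hY.symm).trans ((hf _).mpr rfl)

end Extension

section FourierMotzkin

open MulOpposite

section Span

variable {R V : Type*} [Semiring R] {G : Set (V → R)} {c : V → R}

theorem apply_eq_zero_of_mem_span {v : V} (hG : ∀ g ∈ G, g v = 0)
    (hc : c ∈ Submodule.span R G) : c v = 0 := by
  have hle : Submodule.span R G ≤ LinearMap.ker (LinearMap.proj v : (V → R) →ₗ[R] R) :=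
    Submodule.span_le.mpr hG
  exact hle hc

theorem isLinearMap_of_mem_span [AddCommMonoid V] [Module Rᵐᵒᵖ V]
    (hG : ∀ g ∈ G, IsLinearMap Rᵐᵒᵖ g) (hc : c ∈ Submodule.span R G) : IsLinearMap Rᵐᵒᵖ c := by
  induction hc using Submodule.span_induction with
  | mem g hg => exact hG g hg
  | zero => exact (0 : V →ₗ[Rᵐᵒᵖ] R).isLinear
  | add g h _ _ hg hh => exact (hg.mk' + hh.mk').isLinear
  | smul a g _ hg => exact ⟨fun x y => by simp [hg.map_add, mul_add], fun b x => by
      simp [hg.map_smul, mul_assoc]⟩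

end Span

variable {𝕜 V : Type*} [DivisionRing 𝕜]

section Eliminate

/-- The functionals obtained from `G` by one Fourier–Motzkin elimination step in the direction `v`:
those that vanish at `v`, and the differences of those that do not, normalized at `v`. -/
def eliminate (v : V) (G : Set (V → 𝕜)) : Set (V → 𝕜) :=
  {g ∈ G | g v = 0} ∪
    Set.image2 (fun g h => (g v)⁻¹ • g - (h v)⁻¹ • h) {g ∈ G | g v ≠ 0} {g ∈ G | g v ≠ 0}

variable {v : V} {G : Set (V → 𝕜)} {c : V → 𝕜}

theorem finite_eliminate (hG : G.Finite) (v : V) : (eliminate v G).Finite :=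
  (hG.sep _).union ((hG.sep _).image2 _ (hG.sep _))

theorem eliminate_subset_span (v : V) (G : Set (V → 𝕜)) :
    eliminate v G ⊆ Submodule.span 𝕜 G := by
  rintro _ (⟨hg, -⟩ | ⟨g, ⟨hg, -⟩, h, ⟨hh, -⟩, rfl⟩)
  · exact Submodule.subset_span hg
  · exact sub_mem (Submodule.smul_mem _ _ (Submodule.subset_span hg))
      (Submodule.smul_mem _ _ (Submodule.subset_span hh))

theorem apply_eq_zero_of_mem_eliminate (hc : c ∈ eliminate v G) : c v = 0 := by
  rcases hc with ⟨-, hc⟩ | ⟨g, ⟨-, hg⟩, h, ⟨-, hh⟩, rfl⟩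
  · exact hc
  · simp [inv_mul_cancel₀ hg, inv_mul_cancel₀ hh]

end Eliminate

theorem denselyOrdered_of_divisionRing (𝕜 : Type*) [DivisionRing 𝕜] [LinearOrder 𝕜]
    [IsStrictOrderedRing 𝕜] : DenselyOrdered 𝕜 where
  dense a b hab := by
    have hhalf : (0 : 𝕜) < 2⁻¹ := inv_pos.mpr two_pos
    have add_self_mul_half (c : 𝕜) : (c + c) * 2⁻¹ = c := by
      rw [← mul_two, mul_inv_cancel_right₀ two_ne_zero]
    refine ⟨(a + b) * 2⁻¹, ?_, ?_⟩
    · calc a = (a + a) * 2⁻¹ := (add_self_mul_half a).symm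
        _ < (a + b) * 2⁻¹ := mul_lt_mul_of_pos_right (by gcongr) hhalf
    · calc (a + b) * 2⁻¹ < (b + b) * 2⁻¹ := mul_lt_mul_of_pos_right (by gcongr) hhalf
        _ = b := add_self_mul_half b

theorem exists_sign_sub_eq {ι α : Type*} [AddCommGroup α] [LinearOrder α] [IsOrderedAddMonoid α]
    [DenselyOrdered α] [Nontrivial α] {A : Set ι} (hA : A.Finite) {r s : ι → α}
    (h : ∀ i ∈ A, ∀ j ∈ A, sign (r i - r j) = sign (s i - s j)) (v : α) :
    ∃ t, ∀ i ∈ A, sign (t - r i) = sign (v - s i) := by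
  by_cases hv : ∃ j ∈ A, s j = v
  · obtain ⟨j, hj, rfl⟩ := hv
    exact ⟨r j, fun i hi => h j hj i hi⟩
  push Not at hv
  have lower_lt_upper : ∀ x ∈ r '' {i ∈ A | s i < v}, ∀ y ∈ r '' {i ∈ A | v < s i}, x < y := by
    rintro _ ⟨i, ⟨hi, hiv⟩, rfl⟩ _ ⟨j, ⟨hj, hjv⟩, rfl⟩
    rw [← sub_neg, ← sign_eq_neg_one_iff, h i hi j hj]
    exact sign_neg (sub_neg.mpr (hiv.trans hjv))
  obtain ⟨t, hlower, hupper⟩ := Order.exists_between_finsets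
    ((hA.sep (s · < v)).image r).toFinset ((hA.sep (v < s ·)).image r).toFinset
    (by simpa only [Set.Finite.mem_toFinset] using lower_lt_upper)
  simp only [Set.Finite.mem_toFinset] at hlower hupper
  refine ⟨t, fun i hi => ?_⟩
  rcases (hv i hi).lt_or_gt with hlt | hgt
  · rw [sign_pos (sub_pos.mpr hlt), sign_pos (sub_pos.mpr (hlower _ ⟨i, ⟨hi, hlt⟩, rfl⟩))]
  · rw [sign_neg (sub_neg.mpr hgt), sign_neg (sub_neg.mpr (hupper _ ⟨i, ⟨hi, hgt⟩, rfl⟩))]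

variable [LinearOrder 𝕜] [IsStrictOrderedRing 𝕜] [AddCommMonoid V] [Module 𝕜ᵐᵒᵖ V]
  {G : Set (V → 𝕜)} {v x y : V}

theorem SignEquiv.exists_add_smul_of_eliminate (hfin : G.Finite)
    (hlin : ∀ g ∈ G, IsLinearMap 𝕜ᵐᵒᵖ g) (hxy : SignEquiv (eliminate v G) x y) :
    ∃ t : 𝕜ᵐᵒᵖ, SignEquiv G (x + t • v) y := by
  have := denselyOrdered_of_divisionRing 𝕜
  obtain ⟨t, ht⟩ := exists_sign_sub_eq (hfin.sep (· v ≠ 0)) (r := fun g => -((g v)⁻¹ * g x))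
    (s := fun g => -((g v)⁻¹ * g y)) (v := 0) fun g hg h hh => by
      simpa [neg_add_eq_sub] using hxy _ (Or.inr ⟨h, hh, g, hg, rfl⟩)
  refine ⟨op t, fun g hg => ?_⟩
  rw [(hlin g hg).map_add, (hlin g hg).map_smul, op_smul_eq_mul]
  by_cases hgv : g v = 0
  · simpa [hgv] using hxy g (Or.inl ⟨hg, hgv⟩)
  · calc sign (g x + g v * t) = sign (g v) * sign (t - -((g v)⁻¹ * g x)) := by
          rw [← sign_mul, sub_neg_eq_add, mul_add, mul_inv_cancel_left₀ hgv, add_comm]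
      _ = sign (g v) * sign (0 - -((g v)⁻¹ * g y)) := by rw [ht g ⟨hg, hgv⟩]
      _ = sign (g y) := by
          rw [← sign_mul, zero_sub, neg_neg, mul_inv_cancel_left₀ hgv]

theorem exists_finite_eliminate (S : Finset V) (hfin : G.Finite)
    (hlin : ∀ g ∈ G, IsLinearMap 𝕜ᵐᵒᵖ g) :
    ∃ C : Set (V → 𝕜), C.Finite ∧ C ⊆ Submodule.span 𝕜 G ∧ (∀ c ∈ C, ∀ v ∈ S, c v = 0) ∧
      ∀ x y, SignEquiv C x y → ∃ u ∈ Submodule.span 𝕜ᵐᵒᵖ (S : Set V), SignEquiv G (x + u) y := by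
  classical
  induction S using Finset.induction_on generalizing G with
  | empty =>
    exact ⟨G, hfin, Submodule.subset_span, by simp, fun x y h => ⟨0, zero_mem _, by simpa using h⟩⟩
  | insert v S _ ih =>
    have hspan := eliminate_subset_span v G
    obtain ⟨C, hCfin, hCspan, hCzero, hC⟩ := ih (finite_eliminate hfin v)
      fun g hg => isLinearMap_of_mem_span hlin (hspan hg)
    refine ⟨C, hCfin, hCspan.trans (Submodule.span_le.mpr hspan), fun c hc => ?_, fun x y hxy => ?_⟩
    · exact Finset.forall_mem_insert _ _ _ |>.mpr ⟨apply_eq_zero_of_mem_span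
        (fun g hg => apply_eq_zero_of_mem_eliminate hg) (hCspan hc), hCzero c hc⟩
    · obtain ⟨u, hu, hxu⟩ := hC x y hxy
      obtain ⟨t, ht⟩ := hxu.exists_add_smul_of_eliminate hfin hlin
      refine ⟨u + t • v, add_mem ?_ ?_, by rwa [← add_assoc]⟩
      · exact Submodule.span_mono (by simp) hu
      · exact Submodule.smul_mem _ _ (Submodule.subset_span (by simp))

end FourierMotzkin

section LinFunctional

open MulOpposite

variable {𝕜 J : Type*} [DivisionRing 𝕜]

/-- The left linear map sending `a` to the functional `linFunctional a`. -/
def linFunctionalₗ (𝕜 J : Type*) [DivisionRing 𝕜] : (J →₀ 𝕜) →ₗ[𝕜] (J →₀ 𝕜) → 𝕜 where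
  toFun := linFunctional
  map_add' a b := funext fun x => Finsupp.sum_add_index' (fun _ => zero_mul _)
    fun _ _ _ => add_mul _ _ _
  map_smul' t a := funext fun x => by
    simp [linFunctional, Finsupp.sum_smul_index, Finsupp.mul_sum, mul_assoc]

theorem isLinearMap_linFunctional (a : J →₀ 𝕜) : IsLinearMap 𝕜ᵐᵒᵖ (linFunctional a) where
  map_add x y := by simp [linFunctional, mul_add, Finsupp.sum_add]
  map_smul t x := by simp [linFunctional, Finsupp.sum, Finset.sum_mul, mul_assoc]

theorem linFunctional_single_one (a : J →₀ 𝕜) (j : J) :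
    linFunctional a (Finsupp.single j 1) = a j := by
  classical
  simp +contextual [linFunctional, Finsupp.single_apply, eq_comm]

theorem mem_kkp_iff {I : Set J} {a : J →₀ 𝕜} : a ∈ kkp 𝕜 I ↔ ∀ j ∉ I, a j = 0 := by
  simp only [kkp, Set.mem_ofPred_eq, Set.subset_def, Finset.mem_coe, Finsupp.mem_support_iff,
    not_imp_comm]

theorem linFunctional_eq_zero_of_mem_span {S : Finset J} {a u : J →₀ 𝕜} (ha : ∀ j ∈ S, a j = 0)
    (hu : u ∈ Submodule.span 𝕜ᵐᵒᵖ ((Finsupp.single · (1 : 𝕜)) '' S)) :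
    linFunctional a u = 0 := by
  have hle : Submodule.span 𝕜ᵐᵒᵖ ((Finsupp.single · (1 : 𝕜)) '' S) ≤
      LinearMap.ker (isLinearMap_linFunctional a).mk' :=
    Submodule.span_le.mpr <| Set.forall_mem_image.mpr fun j hj =>
      (linFunctional_single_one a j).trans (ha j hj)
  exact hle hu

variable [LinearOrder 𝕜] [IsStrictOrderedRing 𝕜]

theorem exists_finite_subset_kkp_eliminate (I : Set J) {A : Set (J →₀ 𝕜)} (hA : A.Finite) :
    ∃ C ⊆ linFunctional '' kkp 𝕜 I, C.Finite ∧ ∀ x y, SignEquiv C x y →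
      ∃ u, (∀ a ∈ kkp 𝕜 I, linFunctional a u = 0) ∧ SignEquiv (linFunctional '' A) (x + u) y := by
  classical
  let S : Finset J := {j ∈ hA.toFinset.biUnion Finsupp.support | j ∉ I}
  have apply_eq_zero {j : J} (hjI : j ∉ I) (hjS : j ∉ S) : ∀ a ∈ A, a j = 0 := by
    intro a ha
    by_contra haj
    exact hjS (by simpa [S, hjI] using ⟨a, ha, haj⟩)
  obtain ⟨C, hfin, hspan, hzero, hC⟩ := exists_finite_eliminate
    (S.image (Finsupp.single · 1)) (hA.image linFunctional)
    (Set.forall_mem_image.mpr fun a _ => isLinearMap_linFunctional a)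
  refine ⟨C, fun c hc => ?_, hfin, fun x y hxy => ?_⟩
  · obtain ⟨a, -, rfl⟩ : c ∈ (Submodule.span 𝕜 A).map (linFunctionalₗ 𝕜 J) := by
      rw [Submodule.map_span]
      exact hspan hc
    refine ⟨a, mem_kkp_iff.mpr fun j hj => (linFunctional_single_one a j).symm.trans ?_, rfl⟩
    by_cases hjS : j ∈ S
    · exact hzero _ hc _ (Finset.mem_image_of_mem _ hjS)
    · refine apply_eq_zero_of_mem_span (Set.forall_mem_image.mpr fun b hb => ?_) (hspan hc)
      rw [linFunctional_single_one, apply_eq_zero hj hjS b hb]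
  · obtain ⟨u, hu, hxu⟩ := hC x y hxy
    rw [Finset.coe_image] at hu
    exact ⟨u, fun a ha => linFunctional_eq_zero_of_mem_span
      (fun j hj => mem_kkp_iff.mp ha j (Finset.mem_filter.mp hj).2) hu, hxu⟩

theorem exists_finite_controls (I : Set J) {D : Set (J →₀ 𝕜)} (hD : D.Finite) (e : J →₀ 𝕜) :
    ∃ F₀ ⊆ linFunctional '' (kkp 𝕜 I ∪ D), F₀.Finite ∧
      Controls F₀ (linFunctional '' (kkp 𝕜 I ∪ D)) (linFunctional e) := by
  obtain ⟨C, hCI, hfin, hC⟩ := exists_finite_subset_kkp_eliminate I (hD.insert e)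
  refine ⟨C ∪ linFunctional '' D, ?_, hfin.union (hD.image _), fun x y hxy => ?_⟩
  · rw [Set.image_union]
    exact Set.union_subset_union_left _ hCI
  · obtain ⟨u, hu, hxu⟩ := hC x y (hxy.mono Set.subset_union_left)
    refine ⟨x + u, Set.forall_mem_image.mpr ?_, hxu _ ⟨e, Set.mem_insert _ _, rfl⟩⟩
    rintro d (hd | hd)
    · rw [(isLinearMap_linFunctional d).map_add, hu d hd, add_zero]
    · exact (hxu _ ⟨d, Set.mem_insert_of_mem _ hd, rfl⟩).trans (hxy _ (Or.inr ⟨d, hd, rfl⟩)).symm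

end LinFunctional

theorem OpK_eq_top_iff {𝕜 J : Type*} [DivisionRing 𝕜] [LinearOrder 𝕜] {I : Set J}
    {D : Set (J →₀ 𝕜)} {X : OpK I D} : X = ⊤ ↔ (X : Set (J →₀ 𝕜)) = Set.univ :=
  Subtype.ext_iff

theorem lemmaL_general {𝕜 J L : Type*} [DivisionRing 𝕜] [LinearOrder 𝕜] [IsStrictOrderedRing 𝕜]
    [DistribLattice L] [OrderBot L] (hL : CompletelyNormal L)
    (I : Set J) (D : Set (J →₀ 𝕜)) (hD : D.Finite) (e : J →₀ 𝕜)
    (f : LatticeHom (OpK I D) (WithTop L)) (hf_top : TopFaithful f) :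
    ∃ g : LatticeHom (OpK I (D ∪ {e})) (WithTop L),
      TopFaithful g ∧
        ∀ X : OpK I D, g (Sublattice.inclusion (OpK_mono I Set.subset_union_left) X) = f X := by
  obtain ⟨F₀, hF₀, hfin, hctrl⟩ := exists_finite_controls I hD e
  have hne : (linFunctional '' (kkp 𝕜 I ∪ D)).Nonempty :=
    ⟨_, 0, Or.inl (mem_kkp_iff.mpr fun _ _ => rfl), rfl⟩
  have hinsert : linFunctional '' (kkp 𝕜 I ∪ (D ∪ {e})) =
      insert (linFunctional e) (linFunctional '' (kkp 𝕜 I ∪ D)) := by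
    rw [← Set.union_assoc, Set.union_singleton, Set.image_insert_eq]
  have hf (X : OpK I D) : f X = ⊤ ↔ (X : Set (J →₀ 𝕜)) = Set.univ :=
    (Set.ext_iff.mp hf_top X).trans OpK_eq_top_iff
  obtain ⟨g, hgf, hg⟩ := exists_extension_of_controls hL hne
    (Set.forall_mem_image.mpr fun a _ => isLinearMap_linFunctional a)
    (isLinearMap_linFunctional e) hF₀ hfin hctrl hinsert f hf
  exact ⟨g, Set.ext fun Y => (hg Y).trans OpK_eq_top_iff.symm, fun X => hgf X _ rfl⟩

theorem lemmaL {𝕜 J L : Type*} [DivisionRing 𝕜] [LinearOrder 𝕜] [IsStrictOrderedRing 𝕜]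
    [DistribLattice L] [OrderBot L] (hL : CompletelyNormal L)
    (I : Set J) (D : Set (J →₀ 𝕜)) (hD : D.Finite) (e : J →₀ 𝕜)
    (f : LatticeHom (OpK I D) (WithTop L)) (hf_zero : f ⊥ = ⊥) (hf_top : TopFaithful f) :
    ∃ g : LatticeHom (OpK I (D ∪ {e})) (WithTop L),
      TopFaithful g ∧
        ∀ X : OpK I D, g (Sublattice.inclusion (OpK_mono I Set.subset_union_left) X) = f X :=
  lemmaL_general hL I D hD e f hf_top
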